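/- Let $K$ be a simplicial complex (a family of non-empty finite sets, called simplices, closed under passing to non-empty subsets; $K$ may be infinite and of infinite dimension) and let $L\subseteq K$ be a subcomplex. A simplex $\sigma$ is a \emph{facet} of $\tau$ if $\sigma\subseteq\tau$ and $|\tau|=|\sigma|+1$. A \emph{discrete vector field} on $K$ is a partition $V$ of the set of simplices of $K$ into singletons $\{\sigma\}$ and pairs $\{\sigma,\tau\}$ in which $\sigma$ is a facet of $\tau$. It is a \emph{discrete gradient vector field} if the directed graph whose nodes are the simplices of $K$, with an arc $\sigma\to\tau$ for each $\sigma$ that is a facet of $\tau$ with $\{\sigma,\tau\}\notin V$, and an arc $\tau\to\sigma$ for each $\sigma$ that is a facet of $\tau$ with $\{\sigma,\tau\}\in V$, has no directed cycle. In that case $V$ is partially ordered as follows: $A\le_V B$ if and only if there is a finite sequence $A=C_0,C_1,\dots,C_n=B$ in $V$ such that for every $1\le i\le n$ there are $x_{i-1}\in C_{i-1}$ and $x_i\in C_i$ with $x_{i-1}\subseteq x_i$. The \emph{height} of $A\in V$ is $$\operatorname{ht}(A)=\sup\{n\in\mathbb N \mid \exists\, A=B_0>_V B_1>_V\cdots>_V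 B_n \text{ in } V\}\in\mathbb N\cup\{\infty\}.$$ Let $V$ be a discrete gradient vector field on $K$ such that $\operatorname{ht}(A)<\infty$ for every $A\in V$, and suppose that $K\setminus L$ is a union of pairs in $V$. Then the inclusion $|L|\hookrightarrow|K|$ of geometric realizations (with the weak topology) is a homotopy equivalence. -/

import Mathlib

open scoped Topology

namespace InfiniteDiscreteMorse

/-! ### Geometric realization of an abstract simplicial complex

`PreAbstractSimplicialComplex ι` is a set of non-empty finite subsets of `ι` that is closed under
passing to non-empty subsets; the vertices are those `v : ι` for which `{v}` is a simplex. -/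

/-- The points of the geometric realization `|K|`: barycentric coordinates `t : ι →₀ ℝ` that are
non-negative, sum to `1`, and whose support is a simplex of `K`. -/
structure Realization {ι : Type*} (K : PreAbstractSimplicialComplex ι) where
  coord : ι →₀ ℝ
  nonneg : ∀ v, 0 ≤ coord v
  sum_eq_one : ∑ v ∈ coord.support, coord v = 1
  support_mem : coord.support ∈ K.faces

namespace Realization

variable {ι : Type*} {K L : PreAbstractSimplicialComplex ι}

/-- The closed simplex `|σ| ⊆ |K|`. -/
def closedSimplex (K : PreAbstractSimplicialComplex ι) (σ : Finset ι) : Set (Realization K) :=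
  {x | x.coord.support ⊆ σ}

/-- The Euclidean topology on the closed simplex `|σ|`: that of coordinatewise convergence (only
the finitely many coordinates in `σ` matter). -/
abbrev simplexTopology (K : PreAbstractSimplicialComplex ι) (σ : Finset ι) :
    TopologicalSpace (closedSimplex K σ) :=
  TopologicalSpace.induced (fun x (v : ι) => x.1.coord v) Pi.topologicalSpace

/-- The weak topology on `|K|`: a set is open if and only if its intersection with `|σ|` is open
in `|σ|` for every simplex `σ` of `K` (see `isOpen_iff`). -/
instance instTopologicalSpace : TopologicalSpace (Realization K) :=
  ⨆ σ : K.faces,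
    TopologicalSpace.coinduced (Subtype.val : closedSimplex K σ.1 → Realization K)
      (simplexTopology K σ.1)

theorem isOpen_iff {U : Set (Realization K)} :
    IsOpen U ↔ ∀ σ ∈ K.faces,
      IsOpen[simplexTopology K σ] ((Subtype.val : closedSimplex K σ → Realization K) ⁻¹' U) := by
  refine isOpen_iSup_iff.trans ?_
  simp only [isOpen_coinduced, Subtype.forall]

/-- The inclusion `|L| → |K|` of the realization of a subcomplex, as a function. -/
def inclFun (h : L ≤ K) (x : Realization L) : Realization K where
  coord := x.coord
  nonneg := x.nonneg
  sum_eq_one := x.sum_eq_one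
  support_mem := h x.support_mem

theorem continuous_inclFun (h : L ≤ K) : Continuous (inclFun h) := by
  refine continuous_def.2 fun U hU => isOpen_iff.2 fun σ hσ => ?_
  have hU' := isOpen_iff.1 hU σ (h hσ)
  obtain ⟨W, hW, hWU⟩ := isOpen_induced_iff.1 hU'
  refine isOpen_induced_iff.2 ⟨W, hW, ?_⟩
  ext x
  exact Set.ext_iff.1 hWU ⟨inclFun h x.1, x.2⟩

/-- The inclusion `|L| ↪ |K|`, as a continuous map. -/
def incl (h : L ≤ K) : C(Realization L, Realization K) :=
  ⟨inclFun h, continuous_inclFun h⟩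

end Realization

/-- A continuous map is a homotopy equivalence if it is the underlying map of some homotopy
equivalence `X ≃ₕ Y`, that is, if it has a homotopy inverse. -/
def IsHomotopyEquivalence {X Y : Type*} [TopologicalSpace X] [TopologicalSpace Y]
    (f : C(X, Y)) : Prop :=
  ∃ e : ContinuousMap.HomotopyEquiv X Y, e.toFun = f

/-! ### Discrete gradient vector fields -/

variable {ι : Type*} {K : PreAbstractSimplicialComplex ι}

/-- `σ` is a facet of `τ`: a face of codimension one. -/
def IsFacet (σ τ : Finset ι) : Prop :=
  σ ⊆ τ ∧ τ.card = σ.card + 1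

/-- `A` is a pair `{σ, τ}` with `σ` a facet of `τ`. -/
def IsFacetPair (A : Set (Finset ι)) : Prop :=
  ∃ σ τ : Finset ι, IsFacet σ τ ∧ A = {σ, τ}

/-- A partition `V` of the set of simplices of `K` is a discrete vector field if each of its parts
is a singleton (a critical simplex) or a pair consisting of a simplex and one of its facets. -/
def IsDiscreteVectorField (V : Partition K.faces) : Prop :=
  ∀ A ∈ V, (∃ σ : Finset ι, A = {σ}) ∨ IsFacetPair A

/-- The arcs of the directed graph `H(K, V)` on the simplices of `K`: the arcs `(σ, τ)` of the
Hasse diagram, `σ` a facet of `τ`, with those for which `{σ, τ} ∈ V` reversed. -/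
def ModifiedHasseArc (V : Partition K.faces) (α β : Finset ι) : Prop :=
  α ∈ K.faces ∧ β ∈ K.faces ∧
    ((IsFacet α β ∧ ({α, β} : Set (Finset ι)) ∉ V) ∨
      (IsFacet β α ∧ ({β, α} : Set (Finset ι)) ∈ V))

/-- A discrete gradient vector field: a discrete vector field `V` for which the directed graph
`H(K, V)` has no directed cycle. -/
structure IsDiscreteGradientVectorField (V : Partition K.faces) : Prop where
  isDiscreteVectorField : IsDiscreteVectorField V
  acyclic : ∀ σ : Finset ι, ¬ Relation.TransGen (ModifiedHasseArc V) σ σ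

/-- One step `C, D` of a sequence witnessing `A ≤_V B`: both are elements of `V`, and some element
of `C` is a face of some element of `D`. -/
def FaceStep (V : Partition K.faces) (C D : Set (Finset ι)) : Prop :=
  C ∈ V ∧ D ∈ V ∧ ∃ x ∈ C, ∃ y ∈ D, x ⊆ y

/-- The order `A ≤_V B` on the elements of `V`: there is a finite sequence
`A = C₀, C₁, …, Cₙ = B` in `V` such that, for each `i`, some element of `Cᵢ₋₁` is a face of some
element of `Cᵢ`. -/
def VLE (V : Partition K.faces) (A B : Set (Finset ι)) : Prop :=
  Relation.ReflTransGen (FaceStep V) A B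

/-- The strict order `A <_V B`. -/
def VLT (V : Partition K.faces) (A B : Set (Finset ι)) : Prop :=
  VLE V A B ∧ A ≠ B

/-- The height of `A ∈ V`: the supremum, possibly infinite, of all `n` such that there is a
strictly descending chain `A = B₀ > B₁ > ⋯ > Bₙ` in `V`. -/
noncomputable def height (V : Partition K.faces) (A : Set (Finset ι)) : ℕ∞ :=
  sSup {N : ℕ∞ | ∃ n : ℕ, N = n ∧ ∃ B : ℕ → Set (Finset ι),
    B 0 = A ∧ (∀ i ≤ n, B i ∈ V) ∧ ∀ i < n, VLT V (B (i + 1)) (B i)}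

end InfiniteDiscreteMorse

/-!
The proof constructs a deformation retraction of `|K|` onto `|L|` from a flow. If a pair of `V`
outside `L` consists of `σ` and `τ = σ ∪ {v}`, a point in the interior of `|σ|` or of `|τ|` moves in
the direction `|σ| e_v - ∑_{w ∈ σ} e_w` until one of its coordinates at `σ` vanishes. This happens
after the time `m x = min_{w ∈ σ} x_w`. The point is then in a face of `τ` other than `σ` and `τ`;
unless that face is in `L`, it belongs to a pair of smaller height, whose direction it follows next.
Heights being finite, every point reaches `|L|` after finitely many steps. Recursion on the height
thus defines the flow `S.flow`, the time `S.arrivalTime x` that `x` needs to reach `|L|`, and the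
point `S.retract x` where it arrives.

Measuring time by distance rather than by number of steps makes all three continuous: on the whole
closed cell `|τ|`, the value at `x` is given by a continuous formula in terms of the value at the
point where the first step ends. This holds also for `x` outside the two open simplices of the pair,
because there `m x = 0` and the step does not move `x`. Hence continuity on closed cells follows by
induction on the height (`CollapsingScheme.continuous_on_cells`), which suffices for continuity on
`|K|`, and on `|K| × ℝ` since `ℝ` is locally compact (`Realization.continuous_prod_of_cells`). The
homotopy is `(x, s) ↦ S.flow x (s * S.arrivalTime x)`.

The construction is carried out for a `CollapsingScheme`, which records what is used of `V`: each
simplex outside `L` lies in exactly one of the pairs, and the height strictly drops on passing from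
a pair to another pair that contains a face of its larger simplex.
-/

namespace InfiniteDiscreteMorse

open scoped Classical

variable {ι : Type*} {K L : PreAbstractSimplicialComplex ι}

/-! ### Closed cells and the weak topology -/

namespace Realization

theorem ext_coord {x y : Realization K} (h : ∀ v, x.coord v = y.coord v) : x = y := by
  cases x; cases y; congr; exact Finsupp.ext h

theorem sum_coord_of_support_subset {x : Realization K} {τ : Finset ι}
    (h : x.coord.support ⊆ τ) : ∑ v ∈ τ, x.coord v = 1 := by
  rw [← x.sum_eq_one]
  exact (Finset.sum_subset h fun v _ hv => by simpa using hv).symm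

/-- The closed simplex `|σ|` as a type of its own. It carries the Euclidean topology of
`simplexTopology`; as a subtype of `Realization K` it would get the subspace topology of the weak
topology instead, and the two would first have to be compared. -/
def Cell (K : PreAbstractSimplicialComplex ι) (σ : Finset ι) : Type _ :=
  closedSimplex K σ

namespace Cell

instance (σ : Finset ι) : TopologicalSpace (Cell K σ) :=
  simplexTopology K σ

variable {σ τ : Finset ι}

/-- The point of `|K|` underlying a point of a closed cell. -/
def pt (x : Cell K σ) : Realization K := x.1

theorem support_subset (x : Cell K σ) : x.pt.coord.support ⊆ σ := x.2

theorem ext_pt {x y : Cell K σ} (h : x.pt = y.pt) : x = y := Subtype.ext h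

theorem continuous_pt (hσ : σ ∈ K.faces) : Continuous (pt : Cell K σ → Realization K) := by
  rw [continuous_iff_coinduced_le]
  exact le_iSup (fun σ : K.faces => TopologicalSpace.coinduced
    (Subtype.val : closedSimplex K σ.1 → Realization K) (simplexTopology K σ.1)) ⟨σ, hσ⟩

theorem continuous_coord (v : ι) : Continuous fun x : Cell K σ => x.pt.coord v :=
  (continuous_apply v).comp continuous_induced_dom

theorem continuous_of_coord {Y : Type*} [TopologicalSpace Y] {f : Y → Cell K σ}
    (h : ∀ v, Continuous fun y => (f y).pt.coord v) : Continuous f :=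
  continuous_induced_rng.2 (continuous_pi h)

/-- The inclusion of a closed cell into a larger one. -/
def map (h : σ ⊆ τ) (x : Cell K σ) : Cell K τ := ⟨x.pt, x.support_subset.trans h⟩

theorem continuous_map (h : σ ⊆ τ) : Continuous (map h : Cell K σ → Cell K τ) :=
  continuous_of_coord continuous_coord

/-- The point of `|τ|` with given barycentric coordinates. -/
noncomputable def ofCoord (hτ : τ ∈ K.faces) (g : ι → ℝ) (h0 : ∀ v, 0 ≤ g v)
    (hsupp : ∀ v, g v ≠ 0 → v ∈ τ) (h1 : ∑ v ∈ τ, g v = 1) : Cell K τ :=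
  have hsub : (Finsupp.onFinset τ g hsupp).support ⊆ τ := Finsupp.support_onFinset_subset
  have hsum : ∑ v ∈ (Finsupp.onFinset τ g hsupp).support, Finsupp.onFinset τ g hsupp v = 1 :=
    h1 ▸ Finset.sum_subset hsub fun v _ hv => by simpa using hv
  ⟨{ coord := Finsupp.onFinset τ g hsupp
     nonneg := h0
     sum_eq_one := hsum
     support_mem := K.isRelLowerSet_faces.mem_of_le hτ hsub (by
       rw [Finset.nonempty_iff_ne_empty]
       intro he
       rw [he] at hsum
       simp at hsum) }, hsub⟩

@[simp] theorem ofCoord_coord (hτ : τ ∈ K.faces) (g : ι → ℝ) (h0 : ∀ v, 0 ≤ g v)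
    (hsupp : ∀ v, g v ≠ 0 → v ∈ τ) (h1 : ∑ v ∈ τ, g v = 1) (v : ι) :
    (ofCoord hτ g h0 hsupp h1).pt.coord v = g v := rfl

end Cell

theorem continuous_of_cells {Z : Type*} [TopologicalSpace Z] {g : Realization K → Z}
    (h : ∀ σ ∈ K.faces, Continuous fun x : Cell K σ => g x.pt) : Continuous g :=
  continuous_iSup_dom.2 fun σ => continuous_coinduced_dom.2 (h σ.1 σ.2)

/-- For locally compact `Y`, the product topology on `|K| × Y` is coherent with the products of the
closed cells with `Y`: by currying, a function on `|K| × Y` is a function on `|K|`. -/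
theorem continuous_prod_of_cells {Y Z : Type*} [TopologicalSpace Y] [LocallyCompactSpace Y]
    [TopologicalSpace Z] {g : Realization K → Y → Z}
    (h : ∀ σ ∈ K.faces, Continuous fun p : Cell K σ × Y => g p.1.pt p.2) :
    Continuous fun p : Realization K × Y => g p.1 p.2 := by
  have hg (x : Realization K) : Continuous (g x) := by
    let c : Cell K x.coord.support := ⟨x, Finset.Subset.refl _⟩
    exact (h _ x.support_mem).comp (Continuous.prodMk_right c)
  have hG : Continuous fun x : Realization K => (⟨g x, hg x⟩ : C(Y, Z)) :=
    continuous_of_cells fun σ hσ => ContinuousMap.continuous_of_continuous_uncurry _ (h σ hσ)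
  exact ContinuousMap.continuous_uncurry_of_continuous ⟨_, hG⟩

end Realization

open Realization

/-! ### Sliding a simplex off a free facet -/

/-- A simplex `top = base ∪ {apex}` of `K` together with its facet `base`. -/
@[ext] structure ElementaryPair (K : PreAbstractSimplicialComplex ι) where
  base : Finset ι
  apex : ι
  base_nonempty : base.Nonempty
  apex_notMem : apex ∉ base
  top_mem : insert apex base ∈ K.faces

namespace ElementaryPair

variable (A : ElementaryPair K)

/-- The larger simplex of the pair. -/
noncomputable def top : Finset ι := insert A.apex A.base

theorem base_subset_top : A.base ⊆ A.top := Finset.subset_insert _ _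

/-- The least barycentric coordinate of `x` at a vertex of `base`: how far `x` can be moved
in the direction `A.dir`. -/
noncomputable def margin (x : Realization K) : ℝ := A.base.inf' A.base_nonempty x.coord

/-- The direction `|base| e_apex - ∑_{w ∈ base} e_w`. -/
noncomputable def dir (u : ι) : ℝ :=
  if u = A.apex then (A.base.card : ℝ) else if u ∈ A.base then -1 else 0

theorem margin_nonneg (x : Realization K) : 0 ≤ A.margin x :=
  Finset.le_inf' _ _ fun v _ => x.nonneg v

theorem margin_le {x : Realization K} {w : ι} (hw : w ∈ A.base) : A.margin x ≤ x.coord w :=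
  Finset.inf'_le _ hw

theorem margin_eq_zero {x : Realization K} (h : ¬ A.base ⊆ x.coord.support) : A.margin x = 0 := by
  obtain ⟨w, hw, hwx⟩ := Finset.not_subset.1 h
  have := A.margin_le (x := x) hw
  rw [Finsupp.notMem_support_iff.1 hwx] at this
  exact le_antisymm this (A.margin_nonneg x)

theorem exists_margin_eq (x : Realization K) : ∃ w ∈ A.base, x.coord w = A.margin x := by
  obtain ⟨w, hw, h⟩ := A.base.exists_mem_eq_inf' A.base_nonempty x.coord
  exact ⟨w, hw, h.symm⟩

theorem continuous_margin (σ : Finset ι) : Continuous fun x : Cell K σ => A.margin x.pt :=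
  Continuous.finset_inf'_apply _ fun v _ => Cell.continuous_coord v

theorem sum_dir : ∑ u ∈ A.top, A.dir u = 0 := by
  have h : ∑ u ∈ A.base, A.dir u = ∑ u ∈ A.base, (-1 : ℝ) :=
    Finset.sum_congr rfl fun u hu => by
      have : u ≠ A.apex := fun h => A.apex_notMem (h ▸ hu)
      simp [dir, this, hu]
  rw [top, Finset.sum_insert A.apex_notMem, h]
  simp [dir]

/-- Move `x` for the time `s`, truncated to `[0, A.margin x]`, in the direction `A.dir`. -/
noncomputable def slide (x : Cell K A.top) (s : ℝ) : Cell K A.top :=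
  Cell.ofCoord A.top_mem
    (fun u => x.pt.coord u + max 0 (min s (A.margin x.pt)) * A.dir u)
    (fun u => by
      have h0 : 0 ≤ max 0 (min s (A.margin x.pt)) := le_max_left _ _
      have h1 : max 0 (min s (A.margin x.pt)) ≤ A.margin x.pt :=
        max_le (A.margin_nonneg _) (min_le_right _ _)
      have hx := x.pt.nonneg u
      unfold dir
      split_ifs with h h'
      · positivity
      · linarith [A.margin_le (x := x.pt) h']
      · simpa using hx)
    (fun u hu => by
      by_contra hut
      have h : u ≠ A.apex ∧ u ∉ A.base := by
        simpa [top] using hut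
      have hx : x.pt.coord u = 0 := Finsupp.notMem_support_iff.1 fun h => hut (x.support_subset h)
      simp [dir, h.1, h.2, hx] at hu)
    (by
      change ∑ u ∈ A.top, _ = _
      rw [Finset.sum_add_distrib, ← Finset.mul_sum, A.sum_dir, mul_zero, add_zero]
      exact sum_coord_of_support_subset x.support_subset)

theorem slide_coord (x : Cell K A.top) (s : ℝ) (u : ι) :
    (A.slide x s).pt.coord u =
      x.pt.coord u + max 0 (min s (A.margin x.pt)) * A.dir u := rfl

theorem slide_of_nonpos (x : Cell K A.top) {s : ℝ} (hs : s ≤ 0) : A.slide x s = x := by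
  refine Cell.ext_pt (ext_coord fun v => ?_)
  rw [slide_coord, max_eq_left ((min_le_left _ _).trans hs)]
  simp

theorem continuous_slide : Continuous fun p : Cell K A.top × ℝ => A.slide p.1 p.2 := by
  refine Cell.continuous_of_coord fun v => ?_
  simp only [slide_coord]
  have h1 := (Cell.continuous_coord (K := K) (σ := A.top) v).comp
    (continuous_fst (Y := ℝ))
  have h2 := (A.continuous_margin A.top).comp (continuous_fst (Y := ℝ))
  exact h1.add ((continuous_const.max (continuous_snd.min h2)).mul continuous_const)

/-- Slide as far as possible. This is the elementary collapse of `|top|` onto the union of its facets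
through `apex`. -/
noncomputable def collapse (x : Cell K A.top) : Cell K A.top := A.slide x (A.margin x.pt)

theorem continuous_collapse : Continuous A.collapse :=
  A.continuous_slide.comp (continuous_id.prodMk (A.continuous_margin A.top))

theorem collapse_of_margin_eq_zero (x : Cell K A.top) (h : A.margin x.pt = 0) :
    A.collapse x = x :=
  A.slide_of_nonpos x h.le

theorem collapse_coord_eq_zero (x : Cell K A.top) {w : ι} (hw : w ∈ A.base)
    (h : x.pt.coord w ≤ A.margin x.pt) : (A.collapse x).pt.coord w = 0 := by
  have hwa : w ≠ A.apex := fun h => A.apex_notMem (h ▸ hw)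
  rw [collapse, slide_coord, min_self, max_eq_right (A.margin_nonneg _)]
  simp only [dir, hwa, hw, if_true, if_false]
  linarith [A.margin_le (x := x.pt) hw]

theorem collapse_support_subset_erase (x : Cell K A.top) {w : ι} (hw : w ∈ A.base)
    (h : x.pt.coord w ≤ A.margin x.pt) : (A.collapse x).pt.coord.support ⊆ A.top.erase w :=
  Finset.subset_erase.2 ⟨(A.collapse x).support_subset, by
    simpa using A.collapse_coord_eq_zero x hw h⟩

theorem not_base_subset_collapse_support (x : Cell K A.top) :
    ¬ A.base ⊆ (A.collapse x).pt.coord.support := by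
  obtain ⟨w, hw, h⟩ := A.exists_margin_eq x.pt
  intro hsub
  simpa [A.collapse_coord_eq_zero x hw h.le] using hsub hw

theorem eq_base_or_top {ρ : Finset ι} (h : A.base ⊆ ρ) (h' : ρ ⊆ A.top) :
    ρ = A.base ∨ ρ = A.top := by
  by_cases ha : A.apex ∈ ρ
  · exact Or.inr (h'.antisymm (Finset.insert_subset ha h))
  · exact Or.inl (((Finset.subset_insert_iff_of_notMem ha).1 h').antisymm h)

end ElementaryPair

/-! ### The collapsing flow -/

/-- A decomposition of the simplices of `K` outside `L` into elementary pairs, with a rank function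
that strictly drops from a pair to every other simplex outside `L` that is a face of its larger
simplex. -/
structure CollapsingScheme (K L : PreAbstractSimplicialComplex ι) where
  pair (ρ : Finset ι) (hK : ρ ∈ K.faces) (hL : ρ ∉ L.faces) : ElementaryPair K
  eq_base_or_top (ρ : Finset ι) (hK hL) : ρ = (pair ρ hK hL).base ∨ ρ = (pair ρ hK hL).top
  base_notMem (ρ : Finset ι) (hK hL) : (pair ρ hK hL).base ∉ L.faces
  pair_eq (ρ : Finset ι) (hK hL) (ρ' : Finset ι) (hK' hL')
    (h : ρ' = (pair ρ hK hL).base ∨ ρ' = (pair ρ hK hL).top) : pair ρ' hK' hL' = pair ρ hK hL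
  rank : Finset ι → ℕ
  rank_lt (ρ : Finset ι) (hK hL) (ρ' : Finset ι) (hK' : ρ' ∈ K.faces) (hL' : ρ' ∉ L.faces)
    (hsub : ρ' ⊆ (pair ρ hK hL).top) (hb : ρ' ≠ (pair ρ hK hL).base)
    (ht : ρ' ≠ (pair ρ hK hL).top) : rank ρ' < rank ρ

namespace CollapsingScheme

variable (S : CollapsingScheme K L)

/-- `A` is one of the pairs into which the simplices outside `L` are decomposed. -/
def IsPair (A : ElementaryPair K) : Prop := ∃ ρ hK hL, A = S.pair ρ hK hL

/-- The pair whose open simplices contain a point `x` of `|K|` outside `|L|`. -/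
def pairAt (x : Realization K) (h : x.coord.support ∉ L.faces) : ElementaryPair K :=
  S.pair _ x.support_mem h

/-- A point of `|K|` outside `|L|` as a point of the larger cell of its pair. -/
def cellAt (x : Realization K) (h : x.coord.support ∉ L.faces) : Cell K (S.pairAt x h).top :=
  ⟨x, by
    rcases S.eq_base_or_top _ x.support_mem h with h' | h'
    · exact h'.subset.trans (ElementaryPair.base_subset_top _)
    · exact h'.subset⟩

/-- The point of `|K|` reached from `x` by the elementary collapse of its pair. -/
noncomputable def next (x : Realization K) (h : x.coord.support ∉ L.faces) : Realization K :=
  ((S.pairAt x h).collapse (S.cellAt x h)).pt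

/-- The recursion measure for the functions below: zero on `|L|`. -/
noncomputable def level (x : Realization K) : ℕ :=
  if x.coord.support ∈ L.faces then 0 else S.rank x.coord.support + 1

theorem level_next_lt (x : Realization K) (h : x.coord.support ∉ L.faces) :
    S.level (S.next x h) < S.level x := by
  have hnb := (S.pairAt x h).not_base_subset_collapse_support (S.cellAt x h)
  unfold level
  rw [if_neg h]
  split_ifs with h'
  · omega
  · refine Nat.succ_lt_succ (S.rank_lt _ x.support_mem h _ (S.next x h).support_mem h'
      (Cell.support_subset _) ?_ ?_)
    · exact fun he => hnb he.ge
    · exact fun he => hnb ((ElementaryPair.base_subset_top _).trans he.ge)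

/-- The retraction `|K| → |L|`: apply elementary collapses until `|L|` is reached. -/
noncomputable def retract (x : Realization K) : Realization L :=
  if h : x.coord.support ∈ L.faces then ⟨x.coord, x.nonneg, x.sum_eq_one, h⟩
  else retract (S.next x h)
termination_by S.level x
decreasing_by exact S.level_next_lt x h

/-- The time after which the flow line of `x` reaches `|L|`. -/
noncomputable def arrivalTime (x : Realization K) : ℝ :=
  if h : x.coord.support ∈ L.faces then 0
  else (S.pairAt x h).margin x + arrivalTime (S.next x h)
termination_by S.level x
decreasing_by exact S.level_next_lt x h

/-- The position at time `t` of the point that starts at `x`, slides in the direction of its pair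
for as long as that is possible, goes on with the direction of the pair it has then entered,
and rests once it is in `|L|`. -/
noncomputable def flow (x : Realization K) (t : ℝ) : Realization K :=
  if h : x.coord.support ∈ L.faces then x
  else if t ≤ (S.pairAt x h).margin x then ((S.pairAt x h).slide (S.cellAt x h) t).pt
  else flow (S.next x h) (t - (S.pairAt x h).margin x)
termination_by S.level x
decreasing_by exact S.level_next_lt x h

theorem retract_of_mem {x : Realization K} (h : x.coord.support ∈ L.faces) :
    S.retract x = ⟨x.coord, x.nonneg, x.sum_eq_one, h⟩ := by
  rw [retract, dif_pos h]

theorem arrivalTime_of_mem {x : Realization K} (h : x.coord.support ∈ L.faces) :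
    S.arrivalTime x = 0 := by
  rw [arrivalTime, dif_pos h]

theorem flow_of_mem {x : Realization K} (h : x.coord.support ∈ L.faces) (t : ℝ) :
    S.flow x t = x := by
  rw [flow, dif_pos h]

theorem flow_of_nonpos (x : Realization K) {t : ℝ} (ht : t ≤ 0) : S.flow x t = x := by
  by_cases h : x.coord.support ∈ L.faces
  · exact S.flow_of_mem h t
  · rw [flow, dif_neg h, if_pos (ht.trans (ElementaryPair.margin_nonneg _ _)),
      ElementaryPair.slide_of_nonpos _ _ ht]
    rfl

theorem arrivalTime_nonneg (x : Realization K) : 0 ≤ S.arrivalTime x := by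
  by_cases h : x.coord.support ∈ L.faces
  · exact (S.arrivalTime_of_mem h).ge
  · rw [arrivalTime, dif_neg h]
    exact add_nonneg (ElementaryPair.margin_nonneg _ _) (arrivalTime_nonneg _)
termination_by S.level x
decreasing_by exact S.level_next_lt x h

theorem flow_arrivalTime (hLK : L ≤ K) (x : Realization K) :
    S.flow x (S.arrivalTime x) = incl hLK (S.retract x) := by
  by_cases h : x.coord.support ∈ L.faces
  · rw [S.flow_of_mem h, S.retract_of_mem h]
    rfl
  · have ih := flow_arrivalTime hLK (S.next x h)
    have h0 := S.arrivalTime_nonneg (S.next x h)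
    rw [retract, dif_neg h, ← ih, arrivalTime, dif_neg h, flow, dif_neg h]
    split_ifs with hle
    · have hz : S.arrivalTime (S.next x h) = 0 := by linarith
      rw [hz, add_zero, S.flow_of_nonpos _ le_rfl]
      rfl
    · rw [add_sub_cancel_left]
termination_by S.level x
decreasing_by exact S.level_next_lt x h

/-! ### The recursions on the closed cell of a pair

The defining recursions concern points in the two open simplices of a pair. They persist on the
whole closed cell, because the collapse fixes the rest of it. -/

variable {S} {A : ElementaryPair K}

/-- A point of the closed cell of `A` with positive coordinates at the base lies in one of the two
open simplices of `A`; at the other points of the cell the margin is zero. -/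
theorem IsPair.pairAt_eq (hA : S.IsPair A) {x : Realization K} (hb : A.base ⊆ x.coord.support)
    (ht : x.coord.support ⊆ A.top) :
    ∃ h : x.coord.support ∉ L.faces, S.pairAt x h = A := by
  obtain ⟨ρ, hK, hL, rfl⟩ := hA
  have h : x.coord.support ∉ L.faces := fun h => S.base_notMem ρ hK hL
    (L.isRelLowerSet_faces.mem_of_le h hb (ElementaryPair.base_nonempty _))
  exact ⟨h, S.pair_eq _ _ _ _ _ _ (ElementaryPair.eq_base_or_top _ hb ht)⟩

theorem IsPair.retract_eq (hA : S.IsPair A) (x : Cell K A.top) :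
    S.retract x.pt = S.retract (A.collapse x).pt := by
  by_cases hb : A.base ⊆ x.pt.coord.support
  · obtain ⟨x, hx⟩ := x
    obtain ⟨h, rfl⟩ := hA.pairAt_eq (x := x) hb hx
    exact (retract.eq_1 S x).trans (dif_neg h)
  · rw [A.collapse_of_margin_eq_zero x (A.margin_eq_zero hb)]

theorem IsPair.arrivalTime_eq (hA : S.IsPair A) (x : Cell K A.top) :
    S.arrivalTime x.pt = A.margin x.pt + S.arrivalTime (A.collapse x).pt := by
  by_cases hb : A.base ⊆ x.pt.coord.support
  · obtain ⟨x, hx⟩ := x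
    obtain ⟨h, rfl⟩ := hA.pairAt_eq (x := x) hb hx
    exact (arrivalTime.eq_1 S x).trans (dif_neg h)
  · rw [A.collapse_of_margin_eq_zero x (A.margin_eq_zero hb), A.margin_eq_zero hb, zero_add]

theorem IsPair.flow_eq (hA : S.IsPair A) (x : Cell K A.top) (t : ℝ) :
    S.flow x.pt t = if t ≤ A.margin x.pt then (A.slide x t).pt
      else S.flow (A.collapse x).pt (t - A.margin x.pt) := by
  by_cases hb : A.base ⊆ x.pt.coord.support
  · obtain ⟨x, hx⟩ := x
    obtain ⟨h, rfl⟩ := hA.pairAt_eq (x := x) hb hx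
    exact (flow.eq_1 S x t).trans (dif_neg h)
  · rw [A.collapse_of_margin_eq_zero x (A.margin_eq_zero hb), A.margin_eq_zero hb, sub_zero]
    split_ifs with ht
    · rw [A.slide_of_nonpos x ht, S.flow_of_nonpos _ ht]
    · rfl

/-! ### Continuity -/

variable (S)

/-- Continuity on closed cells by induction on the rank. If a function is continuous on the cells
of `L`, and on the closed cell of each pair its continuity after the collapse implies its
continuity, then it is continuous on all closed cells. Indeed the cell of a pair is the union of
the finitely many closed sets on which the coordinate at a given vertex of the base is the least
one, and the collapse maps each of them into a closed cell of smaller rank. -/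
theorem continuous_on_cells {Y Z : Type*} [TopologicalSpace Y] [TopologicalSpace Z]
    (g : Realization K → Y → Z)
    (hgL : ∀ ρ ∈ L.faces, Continuous fun p : Cell K ρ × Y => g p.1.pt p.2)
    (hgA : ∀ A, S.IsPair A → (Continuous fun p : Cell K A.top × Y => g (A.collapse p.1).pt p.2) →
      Continuous fun p : Cell K A.top × Y => g p.1.pt p.2)
    {ρ : Finset ι} (hρ : ρ ∈ K.faces) :
    Continuous fun p : Cell K ρ × Y => g p.1.pt p.2 := by
  induction hn : S.rank ρ using Nat.strong_induction_on generalizing ρ with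
  | _ n ih =>
  subst hn
  by_cases hL : ρ ∈ L.faces
  · exact hgL ρ hL
  obtain ⟨A, hA⟩ : ∃ A, A = S.pair ρ hρ hL := ⟨_, rfl⟩
  have hρA : ρ ⊆ A.top := by
    rw [hA]
    rcases S.eq_base_or_top ρ hρ hL with h | h
    · exact h.subset.trans (ElementaryPair.base_subset_top _)
    · exact h.subset
  suffices h : Continuous fun p : Cell K A.top × Y => g p.1.pt p.2 from
    h.comp ((Cell.continuous_map hρA).prodMap continuous_id)
  refine hgA A ⟨ρ, hρ, hL, hA⟩ ?_
  let C (w : A.base) : Set (Cell K A.top × Y) := {p | p.1.pt.coord w ≤ A.margin p.1.pt}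
  refine (locallyFinite_of_finite C).continuous ?_ ?_ ?_
  · refine Set.eq_univ_of_forall fun p => Set.mem_iUnion.2 ?_
    obtain ⟨w, hw, h⟩ := A.exists_margin_eq p.1.pt
    exact ⟨⟨w, hw⟩, h.le⟩
  · intro w
    exact isClosed_le ((Cell.continuous_coord _).comp continuous_fst)
      ((A.continuous_margin _).comp continuous_fst)
  · rintro ⟨w, hw⟩
    have hwa : A.apex ≠ w := fun h => A.apex_notMem (h ▸ hw)
    have hmem : A.top.erase w ∈ K.faces :=
      K.isRelLowerSet_faces.mem_of_le A.top_mem (Finset.erase_subset _ _)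
        ⟨A.apex, Finset.mem_erase.2 ⟨hwa, Finset.mem_insert_self _ _⟩⟩
    -- The facet opposite to `w` contains the apex, so it differs from the base as well as the top.
    have hcont : Continuous fun p : Cell K (A.top.erase w) × Y => g p.1.pt p.2 := by
      by_cases hL' : A.top.erase w ∈ L.faces
      · exact hgL _ hL'
      · refine ih _ ?_ hmem rfl
        refine S.rank_lt ρ hρ hL _ hmem hL' (hA ▸ Finset.erase_subset _ _) ?_ ?_
        · rw [← hA]
          exact fun h => Finset.notMem_erase w A.top (h ▸ hw)
        · rw [← hA]
          exact fun h => Finset.notMem_erase w A.top (h.symm ▸ A.base_subset_top hw)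
    rw [continuousOn_iff_continuous_domRestrict]
    let q (p : C ⟨w, hw⟩) : Cell K (A.top.erase w) :=
      ⟨(A.collapse p.1.1).pt, A.collapse_support_subset_erase p.1.1 hw p.2⟩
    have hq : Continuous q := by
      refine Cell.continuous_of_coord fun v => ?_
      change Continuous fun p : C ⟨w, hw⟩ => (A.collapse p.1.1).pt.coord v
      exact (Cell.continuous_coord v).comp
        (A.continuous_collapse.comp (continuous_fst.comp continuous_subtype_val))
    exact hcont.comp (hq.prodMk (continuous_snd.comp continuous_subtype_val))

theorem continuous_retract : Continuous S.retract := by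
  refine continuous_of_cells fun σ hσ => ?_
  refine (S.continuous_on_cells (Y := Unit) (fun x _ => S.retract x) (fun ρ hρ => ?_)
    (fun A hA h => ?_) hσ).comp (Continuous.prodMk_left ())
  · let q (x : Cell K ρ) : Cell L ρ :=
      ⟨⟨x.pt.coord, x.pt.nonneg, x.pt.sum_eq_one, L.isRelLowerSet_faces.mem_of_le hρ
        x.support_subset (K.isRelLowerSet_faces.prop_of_mem x.pt.support_mem)⟩, x.support_subset⟩
    have hq : Continuous q := Cell.continuous_of_coord Cell.continuous_coord
    convert (Cell.continuous_pt hρ).comp (hq.comp continuous_fst) using 2 with p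
    exact S.retract_of_mem _
  · exact h.congr fun p => (hA.retract_eq p.1).symm

theorem continuous_arrivalTime : Continuous S.arrivalTime := by
  refine continuous_of_cells fun σ hσ => ?_
  refine (S.continuous_on_cells (Y := Unit) (fun x _ => S.arrivalTime x) (fun ρ hρ => ?_)
    (fun A hA h => ?_) hσ).comp (Continuous.prodMk_left ())
  · convert continuous_const (y := (0 : ℝ)) using 2 with p
    exact S.arrivalTime_of_mem (L.isRelLowerSet_faces.mem_of_le hρ
        p.1.support_subset (K.isRelLowerSet_faces.prop_of_mem p.1.pt.support_mem))
  · exact (((A.continuous_margin _).comp continuous_fst).add h).congr fun p =>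
      (hA.arrivalTime_eq p.1).symm

theorem continuous_flow (hLK : L ≤ K) :
    Continuous fun p : Realization K × ℝ => S.flow p.1 p.2 := by
  refine continuous_prod_of_cells fun σ hσ => ?_
  refine S.continuous_on_cells S.flow (fun ρ hρ => ?_) (fun A hA h => ?_) hσ
  · convert (Cell.continuous_pt (hLK hρ)).comp (continuous_fst (Y := ℝ)) using 2 with p
    exact S.flow_of_mem (L.isRelLowerSet_faces.mem_of_le hρ
        p.1.support_subset (K.isRelLowerSet_faces.prop_of_mem p.1.pt.support_mem)) _
  · refine Continuous.congr ?_ fun p => (hA.flow_eq p.1 p.2).symm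
    have hm : Continuous fun p : Cell K A.top × ℝ => A.margin p.1.pt :=
      (A.continuous_margin _).comp continuous_fst
    -- At time `margin` the slide has just reached the collapsed point, so the two formulas agree.
    refine Continuous.if_le ((Cell.continuous_pt A.top_mem).comp A.continuous_slide)
      (h.comp (continuous_fst.prodMk (continuous_snd.sub hm))) continuous_snd hm fun p hp => ?_
    simp only [hp, sub_self, S.flow_of_nonpos _ le_rfl]
    rfl

/-- Running the flow line of each point `x` for the time `s * S.arrivalTime x` deforms the identity
of `|K|` at `s = 0` into the retraction onto `|L|` at `s = 1`. -/
theorem isHomotopyEquivalence_incl (S : CollapsingScheme K L) (hLK : L ≤ K) :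
    IsHomotopyEquivalence (incl hLK) := by
  let r : C(Realization K, Realization L) := ⟨S.retract, S.continuous_retract⟩
  have hr : r.comp (incl hLK) = ContinuousMap.id _ := by
    ext x : 1
    exact S.retract_of_mem x.support_mem
  let H : (ContinuousMap.id (Realization K)).Homotopy ((incl hLK).comp r) :=
    { toFun := fun p => S.flow p.2 (p.1 * S.arrivalTime p.2)
      continuous_toFun := (S.continuous_flow hLK).comp (continuous_snd.prodMk
        ((continuous_subtype_val.comp continuous_fst).mul
          (S.continuous_arrivalTime.comp continuous_snd)))
      map_zero_left := fun x => by
        simpa using S.flow_of_nonpos x le_rfl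
      map_one_left := fun x => by
        simpa [r] using S.flow_arrivalTime hLK x }
  exact ⟨{ toFun := incl hLK
           invFun := r
           left_inv := hr ▸ ContinuousMap.Homotopic.refl _
           right_inv := ⟨H.symm⟩ }, rfl⟩

end CollapsingScheme

/-! ### From a discrete gradient vector field to a collapsing scheme -/

/-- Prefixing `A` to a strictly descending chain that starts at `B` makes it longer by one. -/
theorem height_lt_height {V : Partition K.faces} {A B : Set (Finset ι)} (hA : A ∈ V)
    (hBA : VLT V B A) (hB : height V B < ⊤) : height V B < height V A := by
  have hne : Nonempty {N : ℕ∞ | ∃ n : ℕ, N = n ∧ ∃ C : ℕ → Set (Finset ι),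
      C 0 = B ∧ (∀ i ≤ n, C i ∈ V) ∧ ∀ i < n, VLT V (C (i + 1)) (C i)} := by
    have hBV : B ∈ V := by
      rcases Relation.ReflTransGen.cases_head hBA.1 with h | ⟨C, h, -⟩
      · exact h ▸ hA
      · exact h.1
    exact ⟨0, 0, rfl, fun _ => B, rfl, fun _ _ => hBV, by simp⟩
  obtain ⟨n, hn, C, hC0, hCV, hC⟩ := ENat.sSup_mem_of_nonempty_of_lt_top hB
  have hlt : ((n : ℕ) : ℕ∞) < ((n + 1 : ℕ) : ℕ∞) := by exact_mod_cast Nat.lt_succ_self n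
  refine (hn.trans_lt hlt).trans_le (le_sSup ⟨n + 1, rfl, fun i => Nat.casesOn i A C, rfl, ?_, ?_⟩)
  · rintro (_ | i) hi
    · exact hA
    · exact hCV i (by omega)
  · rintro (_ | i) hi
    · simpa [hC0] using hBA
    · exact hC i (by omega)

namespace ElementaryPair

theorem exists_of_isFacet {σ τ : Finset ι} (h : IsFacet σ τ) (hσ : σ ∈ K.faces)
    (hτ : τ ∈ K.faces) : ∃ A : ElementaryPair K, A.base = σ ∧ A.top = τ := by
  obtain ⟨v, hv, rfl⟩ := (Finset.exists_eq_insert_iff (s := σ) (t := τ)).2 ⟨h.1, h.2.symm⟩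
  exact ⟨⟨σ, v, K.isRelLowerSet_faces.prop_of_mem hσ, hv, hτ⟩, rfl, rfl⟩

theorem eq_of_part_eq {A B : ElementaryPair K}
    (h : ({A.base, A.top} : Set (Finset ι)) = {B.base, B.top}) : A = B := by
  have hcA : A.top.card = A.base.card + 1 := Finset.card_insert_of_notMem A.apex_notMem
  have hcB : B.top.card = B.base.card + 1 := Finset.card_insert_of_notMem B.apex_notMem
  obtain ⟨hb, ht⟩ : A.base = B.base ∧ A.top = B.top := by
    rcases Set.pair_eq_pair_iff.1 h with h | h
    · exact h
    · rw [h.1, h.2] at hcA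
      omega
  refine ElementaryPair.ext hb ?_
  have : A.apex ∈ B.top := ht ▸ Finset.mem_insert_self _ _
  exact (Finset.mem_insert.1 this).resolve_right (hb ▸ A.apex_notMem)

end ElementaryPair

/-- The pairs of `V` that fill `K \ L`, ranked by their heights, form a collapsing scheme. -/
theorem nonempty_collapsingScheme {V : Partition K.faces}
    (hheight : ∀ A ∈ V, height V A < ⊤)
    (hpairs : ∃ P : Set (Set (Finset ι)),
      (∀ A ∈ P, A ∈ V ∧ IsFacetPair A) ∧ K.faces \ L.faces = ⋃₀ P) :
    Nonempty (CollapsingScheme K L) := by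
  obtain ⟨P, hP, hKL⟩ := hpairs
  have hex (ρ : Finset ι) (hK : ρ ∈ K.faces) (hL : ρ ∉ L.faces) :
      ∃ A : ElementaryPair K, ({A.base, A.top} : Set (Finset ι)) ∈ V ∧
        (ρ = A.base ∨ ρ = A.top) ∧ A.base ∉ L.faces := by
    obtain ⟨Q, hQ, hρQ⟩ : ρ ∈ ⋃₀ P := hKL ▸ ⟨hK, hL⟩
    have hQKL : ∀ σ ∈ Q, σ ∈ K.faces \ L.faces := fun σ hσ => hKL ▸ ⟨Q, hQ, hσ⟩
    obtain ⟨hQV, σ, τ, hστ, rfl⟩ := hP Q hQ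
    obtain ⟨A, rfl, rfl⟩ := ElementaryPair.exists_of_isFacet hστ (hQKL σ (by simp)).1
      (hQKL τ (by simp)).1
    exact ⟨A, hQV, hρQ, (hQKL _ (by simp)).2⟩
  choose pair hV hmem hbase using hex
  exact ⟨{
    pair := pair
    eq_base_or_top := hmem
    base_notMem := hbase
    pair_eq := fun ρ hK hL ρ' hK' hL' h => ElementaryPair.eq_of_part_eq
      (V.eq_of_mem_inter (hV _ _ _) (hV _ _ _) ⟨hmem ρ' hK' hL', h⟩)
    rank := fun ρ => if h : ρ ∈ K.faces ∧ ρ ∉ L.faces then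
      (height V {(pair ρ h.1 h.2).base, (pair ρ h.1 h.2).top}).toNat else 0
    rank_lt := fun ρ hK hL ρ' hK' hL' hsub hb ht => by
      rw [dif_pos ⟨hK', hL'⟩, dif_pos ⟨hK, hL⟩]
      rw [← Nat.cast_lt (α := ℕ∞), ENat.natCast_toNat (hheight _ (hV _ _ _)).ne,
        ENat.natCast_toNat (hheight _ (hV _ _ _)).ne]
      refine height_lt_height (hV _ _ _) ⟨.single ⟨hV _ _ _, hV _ _ _, ρ', hmem ρ' hK' hL', _,
        Or.inr rfl, hsub⟩, fun he => ?_⟩ (hheight _ (hV _ _ _))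
      have h : ρ' ∈ ({(pair ρ hK hL).base, (pair ρ hK hL).top} : Set (Finset ι)) :=
        he ▸ hmem ρ' hK' hL'
      exact h.elim hb ht }⟩

end InfiniteDiscreteMorse

theorem mainTheorem9 {ι : Type*} (K L : PreAbstractSimplicialComplex ι) (hLK : L ≤ K)
    (V : Partition K.faces)
    (hV : InfiniteDiscreteMorse.IsDiscreteGradientVectorField V)
    (hheight : ∀ A ∈ V, InfiniteDiscreteMorse.height V A < ⊤)
    (hpairs : ∃ P : Set (Set (Finset ι)),
      (∀ A ∈ P, A ∈ V ∧ InfiniteDiscreteMorse.IsFacetPair A) ∧ K.faces \ L.faces = ⋃₀ P) :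
    InfiniteDiscreteMorse.IsHomotopyEquivalence
      (InfiniteDiscreteMorse.Realization.incl hLK) :=
  let ⟨S⟩ := InfiniteDiscreteMorse.nonempty_collapsingScheme hheight hpairs
  S.isHomotopyEquivalence_incl hLK
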